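/- Let $Z\subseteq\mathbb R^d$ and let $G$ be a finite subgroup of the orthogonal group $O(d)$ with $gZ\subseteq Z$ for all $g\in G$. Let $k:Z\times Z\to\mathbb R$ be a continuous positive definite kernel with $k(gz,gz')=k(z,z')$ for all $g\in G$ and $z,z'\in Z$ (for instance an inner product kernel), and let $$k_G(z,z')=\frac1{|G|}\sum_{g\in G}k(gz,z')$$ be the associated invariant kernel, with reproducing kernel Hilbert space $\mathcal H_{k_G}$. Let $\mu$ be a Borel measure on $Z$ that gives positive mass to every nonempty relatively open set, with $\int_Z k(z,z)\,d\mu(z)<\infty$. Let $\lambda_1\ge\lambda_2\ge\dots\ge0$ be the Mercer eigenvalues of $k_G$, i.e. the eigenvalues, with multiplicity, of $f\mapsto\int_Z k_G(\cdot,z')f(z')\,d\mu(z')$ on $L^2(\mu)$ (continued by zeros if only finitely many are positive), with $L^2(\mu)$-orthonormal eigenfunctions $\phi_m$ (for the $m$ with $\lambda_m>0$). Let $p>1$ and suppose that, for constants $C_\lambda,C_\phi>0$, $$\lambda_m\le C_\lambda\,(m|G|)^{-p}\quad(m\ge1),\qquad \sup_{z\in Z}|\phi_m(z)|\le C_\phi\quad\text{whenever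 }\lambda_m>0 .$$ For a regularization parameter $\rho>0$, integers $T\ge0$ and $1\le h\le H$, and $B,R\ge0$, let $\mathcal Q(B,R)$ be the set of all functions $$Q(z)=\max\bigl\{\min\{Q_0(z)+\beta\,b(z),\;H-h+1\},\,0\bigr\},$$ where $Q_0\in\mathcal H_{k_G}$ with $\|Q_0\|_{\mathcal H_{k_G}}\le R$, $\beta\in[0,B]$, and, for some $t\le T$ and $z_1,\dots,z_t\in Z$, $$b(z)=\bigl(k_G(z,z)-k_t(z)^\top(K_t+\rho I)^{-1}k_t(z)\bigr)^{1/2},\quad k_t(z)=(k_G(z,z_i))_{i\le t},\quad K_t=(k_G(z_i,z_j))_{i,j\le t}.$$ For $\epsilon>0$ let $\mathcal N(\epsilon,B,R,G)$ be the smallest cardinality of a subset $\mathcal C\subseteq\mathcal Q(B,R)$ such that every $f\in\mathcal Q(B,R)$ satisfies $\sup_{z\in Z}|f(z)-g(z)|\le\epsilon$ for some $g\in\mathcal C$. Then there is a constant $C>0$ depending only on $p,C_\lambda,C_\phi$ (in particular not on $\epsilon,B,R,G,d,Z,\mu,k,\rho,T,H,h$) such that $\mathcal N(\epsilon,B,R,G)$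 is finite and $$\log\mathcal N(\epsilon,B,R,G)\le C\left[\Bigl(\frac{R^2}{\epsilon^2|G|^p}\Bigr)^{\frac1{p-1}}\Bigl(1+\log^+\frac R\epsilon\Bigr)+\Bigl(\frac{B^2}{\epsilon^2|G|^p}\Bigr)^{\frac2{p-1}}\Bigl(1+\log^+\frac B\epsilon\Bigr)\right],$$ where $\log^+x=\max\{\log x,0\}$ for $x>0$ and $\log^+0=0$. (For $\epsilon\le\min\{R,B\}$, $\log^+$ is the ordinary logarithm.) -/

import Mathlib

open MeasureTheory Set
open scoped NNReal UniformConvergence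

noncomputable section

namespace KOVI

/-- A real kernel is positive definite (in the usual sense of kernel methods) if it is symmetric
and all its finite quadratic forms are nonnegative. -/
def IsPosDefKernel {X : Type*} (k : X → X → ℝ) : Prop :=
  (Matrix.of k).PosSemidef

/-- The real kernel `k`, seen as an operator-valued kernel: `k x y` acts on `ℝ` by
multiplication. -/
def operatorKernel {X : Type*} (k : X → X → ℝ) : Matrix X X (ℝ →L[ℝ] ℝ) :=
  Matrix.of fun x y => k x y • (1 : ℝ →L[ℝ] ℝ)

theorem IsPosDefKernel.operatorKernel {X : Type*} {k : X → X → ℝ} (hk : IsPosDefKernel k) :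
    (operatorKernel k).PosSemidef := by
  have hsymm : ∀ x y, k x y = k y x := fun x y => by
    have := hk.1.apply y x
    simpa using this
  have tfae := (RKHS.posSemidef_tfae (K := KOVI.operatorKernel k)).out 0 2
  refine tfae.mpr ⟨?_, fun v => ?_⟩
  · ext x y
    simp [KOVI.operatorKernel, hsymm x y]
  · have h := hk.2 v
    simp only [KOVI.operatorKernel, Matrix.of_apply, star_trivial] at h ⊢
    have e : (v.sum fun x w => v.sum fun x' w' =>
        inner ℝ ((k x' x • (1 : ℝ →L[ℝ] ℝ)) w) w')
        = v.sum fun i xi => v.sum fun j xj => xi * k i j * xj := by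
      refine Finsupp.sum_congr fun x _ => Finsupp.sum_congr fun x' _ => ?_
      simp [hsymm x x']
      ring
    rw [e]
    simpa using h

/-- The closed ball of radius `R` in the reproducing kernel Hilbert space of `k`, as a set of
real functions. -/
def rkhsBall {X : Type*} {k : X → X → ℝ} (hk : IsPosDefKernel k) (R : ℝ) : Set (X → ℝ) :=
  haveI : Fact (operatorKernel k).PosSemidef := ⟨hk.operatorKernel⟩
  {f | ∃ F : RKHS.OfKernel (operatorKernel k), ‖F‖ ≤ R ∧ ∀ x, F x = f x}

section InvariantKernel

variable {d : ℕ}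
  {G : Subgroup (EuclideanSpace ℝ (Fin d) ≃ₗᵢ[ℝ] EuclideanSpace ℝ (Fin d))}
  {Z : Set (EuclideanSpace ℝ (Fin d))}

/-- The action on `Z ⊆ ℝ^d` of a group `G` of orthogonal transformations that preserves `Z`. -/
def act (hZ : ∀ g ∈ G, ∀ z ∈ Z, g z ∈ Z) (g : G) (z : Z) : Z :=
  ⟨g.1 z.1, hZ g.1 g.2 z.1 z.2⟩

/-- The invariant kernel `k_G(z, z') = |G|⁻¹ ∑_{g ∈ G} k(g z, z')`. -/
def invariantKernel [Fintype G] (hZ : ∀ g ∈ G, ∀ z ∈ Z, g z ∈ Z) (k : Z → Z → ℝ) :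
    Z → Z → ℝ :=
  fun z z' => (Fintype.card G : ℝ)⁻¹ * ∑ g : G, k (act hZ g z) z'

theorem act_inv_mul (hZ : ∀ g ∈ G, ∀ z ∈ Z, g z ∈ Z) (g h : G) (z : Z) :
    act hZ h (act hZ (h⁻¹ * g) z) = act hZ g z := by
  apply Subtype.ext
  change (h.1 * (h⁻¹ * g : G).1) z.1 = g.1 z.1
  rw [← Subgroup.coe_mul, mul_inv_cancel_left]

theorem sum_act_act [Fintype G] {hZ : ∀ g ∈ G, ∀ z ∈ Z, g z ∈ Z} {k : Z → Z → ℝ}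
    (hinv : ∀ (g : G) (z z' : Z), k (act hZ g z) (act hZ g z') = k z z') (z z' : Z) :
    ∑ g : G, ∑ h : G, k (act hZ g z) (act hZ h z')
      = (Fintype.card G : ℝ) ^ 2 * invariantKernel hZ k z z' := by
  have key : ∀ h : G, ∑ g : G, k (act hZ g z) (act hZ h z')
      = ∑ g : G, k (act hZ g z) z' := fun h => by
    refine Fintype.sum_equiv (Equiv.mulLeft h⁻¹) _ _ fun g => ?_
    rw [Equiv.coe_mulLeft, ← hinv h (act hZ (h⁻¹ * g) z) z', act_inv_mul]
  have hne : (Fintype.card G : ℝ) ≠ 0 := by exact_mod_cast Fintype.card_ne_zero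
  rw [Finset.sum_comm, Finset.sum_congr rfl fun h _ => key h]
  simp only [invariantKernel, Finset.sum_const, Finset.card_univ, nsmul_eq_mul]
  field_simp

/-- The invariant kernel of a positive definite kernel is positive definite. -/
theorem IsPosDefKernel.invariantKernel [Fintype G] {hZ : ∀ g ∈ G, ∀ z ∈ Z, g z ∈ Z}
    {k : Z → Z → ℝ} (hk : IsPosDefKernel k)
    (hinv : ∀ (g : G) (z z' : Z), k (act hZ g z) (act hZ g z') = k z z') :
    IsPosDefKernel (invariantKernel hZ k) := by
  have hne : (Fintype.card G : ℝ) ≠ 0 := by exact_mod_cast Fintype.card_ne_zero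
  have hsymm : ∀ x y, k x y = k y x := fun x y => by
    have := hk.1.apply y x
    simpa using this
  have hform : ∀ z z', KOVI.invariantKernel hZ k z z'
      = ((Fintype.card G : ℝ) ^ 2)⁻¹ * ∑ g : G, ∑ h : G, k (act hZ g z) (act hZ h z') := by
    intro z z'
    rw [sum_act_act hinv]
    field_simp
  refine ⟨?_, fun x => ?_⟩
  · ext z z'
    simp only [Matrix.conjTranspose_apply, Matrix.of_apply, star_trivial, hform]
    rw [Finset.sum_comm]
    simp_rw [hsymm (act hZ _ z') (act hZ _ z)]
  · have h := hk.2 (∑ g : G, x.mapDomain (act hZ g))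
    have e : ((∑ g : G, x.mapDomain (act hZ g)).sum fun i xi =>
        (∑ g : G, x.mapDomain (act hZ g)).sum fun j xj => star xi * Matrix.of k i j * xj)
        = ∑ g : G, ∑ h : G, x.sum fun i xi => x.sum fun j xj =>
            xi * k (act hZ g i) (act hZ h j) * xj := by
      rw [← Finsupp.sum_finsetSum_index (by simp) (by intros; simp [add_mul])]
      refine Finset.sum_congr rfl fun g _ => ?_
      rw [Finsupp.sum_mapDomain_index (by simp) (by intros; simp [add_mul])]
      have inner_eq : ∀ i xi, ((∑ g : G, x.mapDomain (act hZ g)).sum fun j xj =>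
          star xi * Matrix.of k (act hZ g i) j * xj)
          = ∑ h : G, x.sum fun j xj => xi * k (act hZ g i) (act hZ h j) * xj := by
        intro i xi
        rw [← Finsupp.sum_finsetSum_index (by simp) (by intros; simp [mul_add])]
        refine Finset.sum_congr rfl fun h _ => ?_
        rw [Finsupp.sum_mapDomain_index (by simp) (by intros; simp [mul_add])]
        simp
      simp only [inner_eq]
      simp only [Finsupp.sum]
      rw [Finset.sum_comm]
    rw [e] at h
    have e2 : (x.sum fun i xi => x.sum fun j xj =>
        star xi * Matrix.of (KOVI.invariantKernel hZ k) i j * xj)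
        = ((Fintype.card G : ℝ) ^ 2)⁻¹ * ∑ g : G, ∑ h : G, x.sum fun i xi => x.sum fun j xj =>
            xi * k (act hZ g i) (act hZ h j) * xj := by
      have swap : ∀ F : G → G → Z → Z → ℝ,
          ∑ g : G, ∑ h : G, ∑ i ∈ x.support, ∑ j ∈ x.support, F g h i j
            = ∑ i ∈ x.support, ∑ j ∈ x.support, ∑ g : G, ∑ h : G, F g h i j := fun F =>
        calc ∑ g : G, ∑ h : G, ∑ i ∈ x.support, ∑ j ∈ x.support, F g h i j
            = ∑ g : G, ∑ i ∈ x.support, ∑ h : G, ∑ j ∈ x.support, F g h i j :=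
              Finset.sum_congr rfl fun g _ => Finset.sum_comm
          _ = ∑ i ∈ x.support, ∑ g : G, ∑ h : G, ∑ j ∈ x.support, F g h i j := Finset.sum_comm
          _ = ∑ i ∈ x.support, ∑ g : G, ∑ j ∈ x.support, ∑ h : G, F g h i j :=
              Finset.sum_congr rfl fun i _ => Finset.sum_congr rfl fun g _ => Finset.sum_comm
          _ = ∑ i ∈ x.support, ∑ j ∈ x.support, ∑ g : G, ∑ h : G, F g h i j :=
              Finset.sum_congr rfl fun i _ => Finset.sum_comm
      simp only [Matrix.of_apply, star_trivial, hform, Finsupp.sum, swap]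
      simp only [Finset.mul_sum, Finset.sum_mul]
      refine Finset.sum_congr rfl fun i _ => Finset.sum_congr rfl fun j _ =>
        Finset.sum_congr rfl fun g _ => Finset.sum_congr rfl fun h _ => ?_
      ring
    rw [e2]
    positivity

end InvariantKernel

/-- `(lam m, phi m)`, `m = 0, 1, 2, …`, is the Mercer eigensystem of the kernel `k` with respect
to the measure `μ`: the eigenvalues of the integral operator `T f (z) = ∫ k(z, z') f(z') dμ(z')`
on `L²(μ)`, listed in decreasing order with multiplicity, with `L²(μ)`-orthonormal
eigenfunctions. A finite list of positive eigenvalues is continued by zeros, and `phi m` carries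
no information when `lam m = 0`. The eigenfunctions of the nonzero eigenvalues span the
orthogonal complement of the null space of `T`, so no eigenvalue is left out. -/
structure IsMercerEigensystem {Z : Type*} [MeasurableSpace Z] (μ : Measure Z)
    (k : Z → Z → ℝ) (lam : ℕ → ℝ) (phi : ℕ → Z → ℝ) : Prop where
  antitone : Antitone lam
  nonneg : ∀ m, 0 ≤ lam m
  memLp : ∀ m, lam m ≠ 0 → MemLp (phi m) 2 μ
  eigen : ∀ m, lam m ≠ 0 → ∀ z, ∫ z', k z z' * phi m z' ∂μ = lam m * phi m z
  orthonormal : ∀ m n, lam m ≠ 0 → lam n ≠ 0 →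
    ∫ z, phi m z * phi n z ∂μ = if m = n then 1 else 0
  complete : ∀ f : Z → ℝ, MemLp f 2 μ → (∀ m, lam m ≠ 0 → ∫ z, phi m z * f z ∂μ = 0) →
    ∀ z, ∫ z', k z z' * f z' ∂μ = 0

/-- The posterior standard deviation of kernel ridge regression with regularization `ρ` at the
inputs `pts`:
`b(z) = (k(z, z) - k_t(z)ᵀ (K_t + ρ I)⁻¹ k_t(z))^{1/2}`. -/
def bonus {Z : Type*} (k : Z → Z → ℝ) (ρ : ℝ) {t : ℕ} (pts : Fin t → Z) (z : Z) : ℝ :=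
  let kvec : Fin t → ℝ := fun i => k z (pts i)
  let K : Matrix (Fin t) (Fin t) ℝ := Matrix.of fun i j => k (pts i) (pts j)
  Real.sqrt (k z z - kvec ⬝ᵥ ((K + ρ • (1 : Matrix (Fin t) (Fin t) ℝ))⁻¹.mulVec kvec))

/-- The class `𝒬(B, R)` of optimistic state-action value functions
`[min {Q₀ + β b, H - h + 1}]⁺` at step `h` of a horizon `H`: `Q₀` in the RKHS ball of radius `R`,
`β ∈ [0, B]`, and `b` the bonus of some `t ≤ T` inputs. It is a subset of the space of real
functions on `Z` with the supremum distance. -/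
def qClass {Z : Type*} {k : Z → Z → ℝ} (hk : IsPosDefKernel k) (ρ : ℝ) (T H h : ℕ) (B R : ℝ) :
    Set (Z →ᵤ ℝ) :=
  {Q | ∃ t ≤ T, ∃ pts : Fin t → Z, ∃ Q₀ ∈ rkhsBall hk R, ∃ β ∈ Icc (0 : ℝ) B,
    Q = UniformFun.ofFun fun z =>
      max (min (Q₀ z + β * bonus k ρ pts z) ((H : ℝ) - h + 1)) 0}

end KOVI

end

/-! Write `k_G(x,y) = ⟨ψ x, ψ y⟩` in a Hilbert space `F`. By Mercer's theorem the vectors with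
`⟨e_m, ψ z⟩ = √λ_m φ_m(z)` form a Hilbert basis of `F` (`IsMercerEigensystem.exists_hilbertBasis`).
The eigenvalue decay and the bounded eigenfunctions then put `ψ z`, uniformly in `z`, within squared
distance `D |G|^{-p} (M+1)^{1-p}` of a fixed subspace of dimension at most `M`
(`exists_submodule_norm_sub_le`, `sum_range_rpow_neg_le`).

An RKHS function is `⟨v, ψ z⟩`, so after truncation it is a point of a ball in dimension `M`. The
bonus is `‖L (ψ z)‖` for a linear contraction `L` (`exists_contraction_bonus_eq`). After truncation
to `V`, only the norms of `βL` on `V` matter, and these are realised by an endomorphism of `V` of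
norm at most `B`, whatever the number of data points (`exists_endomorphism_norm_eq`). The bonus term
is thus a point of a ball in dimension `M²`, which is why its exponent is `2/(p-1)` rather than
`1/(p-1)`.

Volume bounds cover both balls (`exists_finset_cover_closedBall`), and clipping is 1-Lipschitz, so
`coveringNumber_qClass_le` follows. Taking `M` of order `(r²/(ε²|G|^p))^{1/(p-1)}`, with `r = R` or
`r = B`, balances truncation against `ε`. -/

namespace KOVI

/-! ### Volumetric covering of balls in finite-dimensional normed spaces. -/

section Covering

open Module Metric
open scoped ENNReal

variable {E : Type*} [NormedAddCommGroup E] [NormedSpace ℝ E] [FiniteDimensional ℝ E]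

open scoped Function in
/-- The volume bound for an `η`-separated set in a ball of radius `r`. -/
theorem card_le_of_separated {r η : ℝ} (hr : 0 ≤ r) (hη : 0 < η) (s : Finset E)
    (hs : ∀ c ∈ s, ‖c‖ ≤ r) (h : ∀ c ∈ s, ∀ d ∈ s, c ≠ d → η ≤ ‖c - d‖) :
    (s.card : ℝ) ≤ (1 + 2 * r / η) ^ finrank ℝ E := by
  borelize E
  let μ : Measure E := Measure.addHaar
  have hη2 : 0 < η / 2 := by positivity
  have hrη : 0 < r + η / 2 := by positivity
  set A := ⋃ c ∈ s, ball (c : E) (η / 2) with hA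
  have D : Set.Pairwise (s : Set E) (Disjoint on fun c => ball (c : E) (η / 2)) := by
    rintro c hc d hd hcd
    apply ball_disjoint_ball
    rw [dist_eq_norm]
    linarith [h c hc d hd hcd]
  have A_subset : A ⊆ ball (0 : E) (r + η / 2) := by
    refine iUnion₂_subset fun x hx => ball_subset_ball' ?_
    rw [dist_zero_right]
    linarith [hs x hx]
  have I : (s.card : ℝ≥0∞) * ENNReal.ofReal ((η / 2) ^ finrank ℝ E) * μ (ball 0 1) ≤
      ENNReal.ofReal ((r + η / 2) ^ finrank ℝ E) * μ (ball 0 1) :=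
    calc
      (s.card : ℝ≥0∞) * ENNReal.ofReal ((η / 2) ^ finrank ℝ E) * μ (ball 0 1) = μ A := by
        rw [hA, measure_biUnion_finset D fun c _ => measurableSet_ball]
        simp only [μ.addHaar_ball_of_pos _ hη2]
        simp only [Finset.sum_const, nsmul_eq_mul, mul_assoc]
      _ ≤ μ (ball (0 : E) (r + η / 2)) := measure_mono A_subset
      _ = ENNReal.ofReal ((r + η / 2) ^ finrank ℝ E) * μ (ball 0 1) := by
        simp only [μ.addHaar_ball_of_pos _ hrη]
  have J : (s.card : ℝ≥0∞) * ENNReal.ofReal ((η / 2) ^ finrank ℝ E) ≤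
      ENNReal.ofReal ((r + η / 2) ^ finrank ℝ E) :=
    (ENNReal.mul_le_mul_iff_left (measure_ball_pos _ _ zero_lt_one).ne' measure_ball_lt_top.ne).1 I
  have K := ENNReal.toReal_le_of_le_ofReal (pow_nonneg hrη.le _) J
  rw [ENNReal.toReal_mul, ENNReal.toReal_natCast, ENNReal.toReal_ofReal (by positivity),
    ← le_div_iff₀ (by positivity), ← div_pow] at K
  have e : 1 + 2 * r / η = (r + η / 2) / (η / 2) := by
    field_simp
    ring
  rwa [e]

/-- The covering number is at most the packing number, and the volume bound controls the latter. -/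
theorem exists_finset_cover_closedBall {r η : ℝ} (hr : 0 ≤ r) (hη : 0 < η) :
    ∃ s : Finset E, (s.card : ℝ) ≤ (1 + 2 * r / η) ^ finrank ℝ E ∧
      ∀ x : E, ‖x‖ ≤ r → ∃ c ∈ s, ‖x - c‖ ≤ η := by
  set N := ⌊(1 + 2 * r / η) ^ finrank ℝ E⌋₊ with hN
  set η' : ℝ≥0 := ⟨η, hη.le⟩
  have hpack : packingNumber η' (closedBall (0 : E) r) ≤ N := by
    refine iSup_le fun C => iSup_le fun hC => iSup_le fun hsep => ?_
    by_contra! hlt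
    -- A separated set may a priori be infinite; `N + 1` of its points already contradict the volume
    -- bound.
    obtain ⟨C', hC', hcard⟩ := Set.exists_subset_encard_eq
      (k := ((N + 1 : ℕ) : ℕ∞)) (s := C) (by exact_mod_cast Order.add_one_le_of_lt hlt)
    have hfin : C'.Finite := Set.finite_of_encard_eq_coe hcard
    have hc : hfin.toFinset.card = N + 1 := by
      have := hfin.encard_eq_coe_toFinset_card
      rw [hcard] at this
      exact_mod_cast this.symm
    have := card_le_of_separated hr hη hfin.toFinset
      (fun c hc => by
        have := hC (hC' (hfin.mem_toFinset.1 hc))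
        simpa using this)
      (fun c hc d hd hcd => by
        have h1 := hsep (hC' (hfin.mem_toFinset.1 hc)) (hC' (hfin.mem_toFinset.1 hd)) hcd
        rw [← dist_eq_norm]
        have h2 : ENNReal.ofReal η < ENNReal.ofReal (dist c d) := by
          rw [← edist_dist]
          convert h1 using 1
          exact ENNReal.ofReal_eq_coe_nnreal hη.le
        exact (ENNReal.ofReal_lt_ofReal_iff_of_nonneg hη.le).1 h2 |>.le)
    have h3 : hfin.toFinset.card ≤ N := Nat.le_floor this
    omega
  have hcov := (coveringNumber_le_packingNumber η' (closedBall (0 : E) r)).trans hpack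
  have hne : coveringNumber η' (closedBall (0 : E) r) ≠ ⊤ :=
    ne_top_of_le_ne_top (ENat.natCast_ne_top N) hcov
  obtain ⟨C, hC, hCfin, hcover, hcard⟩ := exists_set_encard_eq_coveringNumber hne
  refine ⟨hCfin.toFinset, ?_, fun x hx => ?_⟩
  · rw [← hcard, hCfin.encard_eq_coe_toFinset_card] at hcov
    have : hCfin.toFinset.card ≤ N := by exact_mod_cast hcov
    exact (Nat.cast_le.2 this).trans (Nat.floor_le (by positivity))
  · obtain ⟨c, hc, hxc⟩ := hcover (show x ∈ closedBall (0 : E) r by simpa using hx)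
    refine ⟨c, by simpa using hc, ?_⟩
    rw [← dist_eq_norm]
    have h2 : ENNReal.ofReal (dist x c) ≤ ENNReal.ofReal η := by
      rw [← edist_dist]
      rw [ENNReal.ofReal_eq_coe_nnreal hη.le]
      exact hxc
    exact (ENNReal.ofReal_le_ofReal_iff hη.le).1 h2

end Covering

/-! ### Linear-algebraic form of the bonus. -/

section Hilbert

variable {F : Type*} [NormedAddCommGroup F] [InnerProductSpace ℝ F]

/-- A linear map out of a finite-dimensional inner product space has the same norms as an
endomorphism of that space. -/
theorem exists_endomorphism_norm_eq {V : Type*} [NormedAddCommGroup V] [InnerProductSpace ℝ V]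
    [FiniteDimensional ℝ V] (W : V →ₗ[ℝ] F) :
    ∃ S : V →L[ℝ] V, ∀ v, ‖S v‖ = ‖W v‖ := by
  classical
  let b := stdOrthonormalBasis ℝ W.range
  let c := stdOrthonormalBasis ℝ V
  have hle : Module.finrank ℝ W.range ≤ Module.finrank ℝ V := LinearMap.finrank_range_le W
  -- The range of `W` has dimension at most that of `V`, so it embeds isometrically into `V`;
  -- composing with `W` keeps all norms.
  let f : W.range →ₗ[ℝ] V := b.toBasis.constr ℝ fun i => c (Fin.castLE hle i)
  have hb : Orthonormal ℝ b.toBasis := by simp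
  have hf : Orthonormal ℝ (f ∘ b.toBasis) := by
    have : f ∘ b.toBasis = c ∘ Fin.castLE hle := by
      ext i
      exact b.toBasis.constr_basis ℝ _ i
    rw [this]
    exact c.orthonormal.comp _ (Fin.castLE_injective hle)
  let g := f.isometryOfOrthonormal hb hf
  refine ⟨LinearMap.toContinuousLinearMap (g.toLinearMap ∘ₗ W.rangeRestrict), fun v => ?_⟩
  change ‖g (W.rangeRestrict v)‖ = ‖W v‖
  rw [g.norm_map]
  rfl

/-- The posterior standard deviation is the norm of a linear contraction of the feature vector. -/
theorem exists_contraction_bonus_eq [CompleteSpace F] {X : Type*} {k : X → X → ℝ} (ψ : X → F)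
    (hψ : ∀ x y, k x y = inner ℝ (ψ x) (ψ y)) {ρ : ℝ} (hρ : 0 < ρ) {t : ℕ} (pts : Fin t → X) :
    ∃ L : F →ₗ[ℝ] WithLp 2 (F × EuclideanSpace ℝ (Fin t)),
      (∀ v, ‖L v‖ ≤ ‖v‖) ∧ ∀ z, bonus k ρ pts z = ‖L (ψ z)‖ := by
  let K : Matrix (Fin t) (Fin t) ℝ := Matrix.of fun i j => k (pts i) (pts j)
  let A : Matrix (Fin t) (Fin t) ℝ := K + ρ • (1 : Matrix (Fin t) (Fin t) ℝ)
  have hK : K.PosSemidef := by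
    have : K = Matrix.gram ℝ (ψ ∘ pts) := by
      ext i j
      simp [K, hψ, Matrix.gram]
    rw [this]
    exact Matrix.posSemidef_gram ℝ _
  have hA : A.PosDef := Matrix.PosDef.posSemidef_add hK (Matrix.PosDef.one.smul hρ)
  have hdet : IsUnit A.det := (Matrix.isUnit_iff_isUnit_det A).1 hA.isUnit
  let Φ : F →ₗ[ℝ] (Fin t → ℝ) := LinearMap.pi fun i => (innerₛₗ ℝ (ψ (pts i)))
  have hΦ : ∀ v i, Φ v i = inner ℝ (ψ (pts i)) v := fun v i => rfl
  let W : F →ₗ[ℝ] (Fin t → ℝ) := A⁻¹.mulVecLin ∘ₗ Φ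
  let Φt : (Fin t → ℝ) →ₗ[ℝ] F := Fintype.linearCombination ℝ (ψ ∘ pts)
  let toE : (Fin t → ℝ) →ₗ[ℝ] EuclideanSpace ℝ (Fin t) :=
    (WithLp.linearEquiv 2 ℝ (Fin t → ℝ)).symm.toLinearMap
  -- `W v` is the ridge regression coefficient vector, minimising `‖v - Φt w‖² + ρ |w|²` over `w`.
  -- The two components of `L v` are the residual and the scaled penalty, so `‖L v‖²` is the minimum
  -- value, which is the expression under the root in the bonus when `v = ψ z`.
  let L : F →ₗ[ℝ] WithLp 2 (F × EuclideanSpace ℝ (Fin t)) :=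
    (WithLp.linearEquiv 2 ℝ (F × EuclideanSpace ℝ (Fin t))).symm.toLinearMap ∘ₗ
      LinearMap.prod (LinearMap.id - Φt ∘ₗ W) (Real.sqrt ρ • (toE ∘ₗ W))
  have hinner : ∀ v w, inner ℝ v (Φt w) = w ⬝ᵥ Φ v := by
    intro v w
    simp only [Φt, Fintype.linearCombination_apply, inner_sum, inner_smul_right, dotProduct, hΦ,
      Function.comp]
    exact Finset.sum_congr rfl fun i _ => by rw [real_inner_comm]
  have hΦΦ : ∀ w, Φ (Φt w) = K.mulVec w := by
    intro w
    ext i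
    simp only [hΦ, Φt, Fintype.linearCombination_apply, inner_sum, inner_smul_right,
      Matrix.mulVec, dotProduct, K, Matrix.of_apply, hψ, Function.comp]
    exact Finset.sum_congr rfl fun j _ => by ring
  have hAW : ∀ v, A.mulVec (W v) = Φ v := by
    intro v
    simp only [W, LinearMap.comp_apply, Matrix.mulVecLin_apply, Matrix.mulVec_mulVec,
      Matrix.mul_nonsing_inv A hdet, Matrix.one_mulVec]
  have hL : ∀ v, ‖L v‖ ^ 2 = ‖v‖ ^ 2 - Φ v ⬝ᵥ (A⁻¹.mulVec (Φ v)) := by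
    intro v
    have h1 : ‖L v‖ ^ 2 = ‖v - Φt (W v)‖ ^ 2 + ‖Real.sqrt ρ • toE (W v)‖ ^ 2 :=
      WithLp.prod_norm_sq_eq_of_L2 (L v)
    have h2 : ‖toE (W v)‖ ^ 2 = W v ⬝ᵥ W v := by
      rw [EuclideanSpace.norm_sq_eq]
      simp [toE, dotProduct, sq]
    have h3 : W v ⬝ᵥ Φ v = W v ⬝ᵥ K.mulVec (W v) + ρ * (W v ⬝ᵥ W v) := by
      rw [← hAW v]
      simp [A, Matrix.add_mulVec, dotProduct_add, Matrix.smul_mulVec]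
    have h4 : Φ v ⬝ᵥ (A⁻¹.mulVec (Φ v)) = W v ⬝ᵥ Φ v := by
      rw [dotProduct_comm]
      rfl
    rw [h1, norm_sub_sq_real, norm_smul, mul_pow, h2, hinner, ← real_inner_self_eq_norm_sq (Φt _),
      hinner, hΦΦ, h4, Real.norm_of_nonneg (Real.sqrt_nonneg _), Real.sq_sqrt hρ.le]
    linarith
  refine ⟨L, fun v => ?_, fun z => ?_⟩
  · rw [← sq_le_sq₀ (norm_nonneg _) (norm_nonneg _), hL]
    have := hA.inv.posSemidef.dotProduct_mulVec_nonneg (Φ v)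
    rw [star_trivial] at this
    linarith
  · have hkv : (fun i => k z (pts i)) = Φ (ψ z) := by
      ext i
      rw [hΦ, hψ, real_inner_comm]
    rw [bonus, hkv, hψ z z, real_inner_self_eq_norm_sq, ← Real.sqrt_sq (norm_nonneg (L (ψ z))), hL]

end Hilbert

/-! ### Mercer expansion of the feature map and its truncation. -/

section Mercer

/-- The canonical feature map of a kernel, whose inner products represent the RKHS ball. -/
theorem exists_feature_map {X : Type} {k : X → X → ℝ} (hk : IsPosDefKernel k) :
    ∃ (F : Type) (_ : NormedAddCommGroup F) (_ : InnerProductSpace ℝ F) (_ : CompleteSpace F)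
      (ψ : X → F), (∀ x y, k x y = inner ℝ (ψ x) (ψ y)) ∧
      (∀ v, (∀ x, inner ℝ v (ψ x) = 0) → v = 0) ∧
      ∀ R f, f ∈ rkhsBall hk R → ∃ v : F, ‖v‖ ≤ R ∧ ∀ x, f x = inner ℝ v (ψ x) := by
  have : Fact (operatorKernel k).PosSemidef := ⟨hk.operatorKernel⟩
  have happ : ∀ (v : RKHS.OfKernel (operatorKernel k)) (x : X),
      v x = inner ℝ v (RKHS.kerFun (𝕜 := ℝ) (RKHS.OfKernel (operatorKernel k)) x (1 : ℝ)) := by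
    intro v x
    rw [RKHS.inner_kerFun]
    simp
  refine ⟨RKHS.OfKernel (operatorKernel k), inferInstance, inferInstance, inferInstance,
    fun x => RKHS.kerFun (𝕜 := ℝ) _ x (1 : ℝ), fun x y => ?_, fun v hv => ?_, ?_⟩
  · rw [real_inner_comm, ← RKHS.kernel_inner, RKHS.OfKernel.kernel_ofKernel]
    simp [operatorKernel]
  · refine RKHS.ext (𝕜 := ℝ) (X := X) (V := ℝ) fun x => ?_
    rw [happ, hv x]
    simp
  · rintro R f ⟨v, hv, hf⟩
    exact ⟨v, hv, fun x => by rw [← hf x, happ]⟩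

variable {F : Type*} [NormedAddCommGroup F] [InnerProductSpace ℝ F]
variable {X : Type*} [TopologicalSpace X]

/-- The distance `‖ψ y - ψ x‖` is expressed through the kernel alone. -/
theorem continuous_feature_map {k : X → X → ℝ} {ψ : X → F}
    (hψ : ∀ x y, k x y = inner ℝ (ψ x) (ψ y)) (hk : Continuous fun q : X × X => k q.1 q.2) :
    Continuous ψ := by
  rw [continuous_iff_continuousAt]
  intro x
  rw [ContinuousAt, tendsto_iff_norm_sub_tendsto_zero]
  have h : ∀ y, ‖ψ y - ψ x‖ = Real.sqrt (k y y - 2 * k y x + k x x) := by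
    intro y
    rw [hψ, hψ, hψ, real_inner_self_eq_norm_sq, real_inner_self_eq_norm_sq, ← norm_sub_sq_real,
      Real.sqrt_sq (norm_nonneg _)]
  simp_rw [h]
  have hc : Continuous fun y => Real.sqrt (k y y - 2 * k y x + k x x) := by
    have h1 : Continuous fun y => k y y := hk.comp (continuous_id.prodMk continuous_id)
    have h2 : Continuous fun y => k y x := hk.comp (continuous_id.prodMk continuous_const)
    fun_prop
  convert hc.tendsto x using 2
  rw [show k x x - 2 * k x x + k x x = 0 by ring, Real.sqrt_zero]

variable [SecondCountableTopology X] [MeasurableSpace X] [BorelSpace X]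

/-- Mercer's theorem in the feature space: the rescaled eigenfunctions are a Hilbert basis. -/
theorem IsMercerEigensystem.exists_hilbertBasis [CompleteSpace F] {μ : Measure X}
    [μ.IsOpenPosMeasure] {k : X → X → ℝ} {lam : ℕ → ℝ} {phi : ℕ → X → ℝ}
    (h : IsMercerEigensystem μ k lam phi) {ψ : X → F}
    (hψ : ∀ x y, k x y = inner ℝ (ψ x) (ψ y)) (hc : Continuous ψ)
    (hsep : ∀ v, (∀ x, inner ℝ v (ψ x) = 0) → v = 0) (hint : Integrable (fun z => k z z) μ) :
    ∃ b : HilbertBasis {m // lam m ≠ 0} ℝ F,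
      ∀ m z, inner ℝ (b m) (ψ z) = Real.sqrt (lam m) * phi m z := by
  have hψ2 : MemLp ψ 2 μ := by
    rw [memLp_two_iff_integrable_sq_norm hc.aestronglyMeasurable]
    simpa only [hψ, real_inner_self_eq_norm_sq] using hint
  have hmem : ∀ v : F, MemLp (fun z => inner ℝ v (ψ z)) 2 μ := fun v => hψ2.const_inner v
  -- `J` regards a vector as the `L²` function `⟨v, ψ ·⟩`. Its adjoint, evaluated against `ψ z`, is
  -- the integral operator of `k` (`hadj`), so `λ_m^{-1/2} J* φ_m` are the candidate basis vectors.
  let J₀ : F →ₗ[ℝ] Lp ℝ 2 μ :=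
    { toFun := fun v => (hmem v).toLp _
      map_add' := fun v w => by
        rw [← MemLp.toLp_add]
        congr 1
        ext z
        simp [inner_add_left]
      map_smul' := fun c v => by
        rw [RingHom.id_apply, ← MemLp.toLp_const_smul]
        congr 1
        ext z
        simp [inner_smul_left] }
  let J : F →L[ℝ] Lp ℝ 2 μ := J₀.mkContinuous (eLpNorm ψ 2 μ).toReal fun v => by
    change ‖(hmem v).toLp _‖ ≤ _
    rw [Lp.norm_toLp, mul_comm, ← ENNReal.ofReal_toReal hψ2.eLpNorm_ne_top]
    refine ENNReal.toReal_le_of_le_ofReal (by positivity) ?_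
    rw [ENNReal.toReal_ofReal (by positivity)]
    refine (eLpNorm_le_mul_eLpNorm_of_ae_le_mul (g := ψ) (c := ‖v‖) (by
      filter_upwards with z
      exact norm_inner_le_norm _ _) 2).trans ?_
    rw [ENNReal.ofReal_mul (norm_nonneg _), ENNReal.ofReal_toReal hψ2.eLpNorm_ne_top]
  have hJ : ∀ v, J v = (hmem v).toLp _ := fun v => rfl
  have hJinner : ∀ v {g : X → ℝ} (hg : MemLp g 2 μ),
      inner ℝ (J v) (hg.toLp g) = ∫ z, inner ℝ v (ψ z) * g z ∂μ := by
    intro v g hg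
    rw [L2.inner_def]
    refine integral_congr_ae ?_
    filter_upwards [(hmem v).coeFn_toLp, hg.coeFn_toLp] with z h1 h2
    rw [hJ, h1, h2]
    simp [mul_comm]
  have hadj : ∀ {g : X → ℝ} (hg : MemLp g 2 μ) z,
      inner ℝ (ψ z) (J.adjoint (hg.toLp g)) = ∫ z', k z z' * g z' ∂μ := by
    intro g hg z
    rw [ContinuousLinearMap.adjoint_inner_right, hJinner]
    simp only [hψ]
  have hpos : ∀ m : {m // lam m ≠ 0}, 0 < lam m := fun m => (h.nonneg m).lt_of_ne' m.2
  let e : {m // lam m ≠ 0} → F := fun m =>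
    (Real.sqrt (lam m))⁻¹ • J.adjoint ((h.memLp m m.2).toLp (phi m))
  have he : ∀ m z, inner ℝ (e m) (ψ z) = Real.sqrt (lam m) * phi m z := by
    intro m z
    rw [real_inner_comm, inner_smul_right, hadj, h.eigen m m.2 z, ← mul_assoc]
    congr 1
    have := Real.sqrt_pos.2 (hpos m)
    rw [inv_mul_eq_iff_eq_mul₀ this.ne', Real.mul_self_sqrt (h.nonneg m)]
  have hJe : ∀ m v, inner ℝ (e m) v =
      (Real.sqrt (lam m))⁻¹ * ∫ z, phi m z * inner ℝ v (ψ z) ∂μ := by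
    intro m v
    rw [real_inner_comm, inner_smul_right, ContinuousLinearMap.adjoint_inner_right, hJinner]
    simp only [mul_comm]
  have hortho : Orthonormal ℝ e := by
    classical
    rw [orthonormal_iff_ite]
    intro m n
    have hm := Real.sqrt_pos.2 (hpos m)
    rw [hJe]
    simp only [he]
    have : ∀ z, phi m z * (Real.sqrt (lam n) * phi n z) =
        Real.sqrt (lam n) * (phi m z * phi n z) := fun z => by ring
    simp only [this]
    rw [integral_const_mul, h.orthonormal m n m.2 n.2]
    by_cases hmn : m = n
    · subst hmn
      simp [hm.ne']
    · simp [hmn, Subtype.coe_injective.ne hmn]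
  -- If `v` is orthogonal to every `e m`, then `J v` is orthogonal to every eigenfunction, so
  -- completeness gives `J* J v = 0` and hence `J v = 0`.
  have hbot : (Submodule.span ℝ (range e))ᗮ = ⊥ := by
    rw [Submodule.eq_bot_iff]
    intro v hv
    have hv0 : ∀ m, inner ℝ (e m) v = 0 := fun m =>
      (Submodule.mem_orthogonal _ _).1 hv _ (Submodule.subset_span (mem_range_self m))
    have hT : ∀ z, ∫ z', k z z' * inner ℝ v (ψ z') ∂μ = 0 := by
      refine h.complete _ (hmem v) fun m hm => ?_
      have := hv0 ⟨m, hm⟩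
      rw [hJe] at this
      exact (mul_eq_zero.1 this).resolve_left (inv_ne_zero (Real.sqrt_pos.2 (hpos ⟨m, hm⟩)).ne')
    have hJJ : J.adjoint (J v) = 0 := by
      refine hsep _ fun z => ?_
      rw [real_inner_comm, hJ, hadj]
      exact hT z
    have hJ0 : J v = 0 := by
      rw [← inner_self_eq_zero (𝕜 := ℝ), ← ContinuousLinearMap.adjoint_inner_right, hJJ,
        inner_zero_right]
    have hae : (fun z => inner ℝ v (ψ z)) =ᵐ[μ] fun _ => 0 := by
      have := (hmem v).coeFn_toLp
      rw [← hJ, hJ0] at this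
      exact this.symm.trans (Lp.coeFn_zero _ _ _)
    -- Continuity and full support of `μ` turn almost everywhere into everywhere.
    have := (Continuous.ae_eq_iff_eq μ (by fun_prop) continuous_const).1 hae
    exact hsep v fun x => congrFun this x
  refine ⟨HilbertBasis.mkOfOrthogonalEqBot hortho hbot, fun m z => ?_⟩
  rw [HilbertBasis.coe_mkOfOrthogonalEqBot, he]

/-- Truncating the Mercer expansion of the feature map. -/
theorem exists_submodule_norm_sub_le {F X : Type*} [NormedAddCommGroup F] [InnerProductSpace ℝ F]
    [CompleteSpace F] {p : ℕ → Prop} (b : HilbertBasis {m // p m} ℝ F) (ψ : X → F)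
    {a : ℕ → ℝ} (ha : ∀ m, 0 ≤ a m) (hb : ∀ m z, inner ℝ (b m) (ψ z) ^ 2 ≤ a m) (M : ℕ) {τ : ℝ}
    (hτ : ∀ n, ∑ i ∈ Finset.range n, a (M + i) ≤ τ) :
    ∃ (V : Submodule ℝ F) (_ : FiniteDimensional ℝ V), Module.finrank ℝ V ≤ M ∧
      ∀ z, ‖ψ z - V.starProjection (ψ z)‖ ^ 2 ≤ τ := by
  classical
  let s : Set {m // p m} := {m | m.1 < M}
  have hsM : ∀ m ∈ Subtype.val '' s, m < M := by
    rintro _ ⟨m, hm, rfl⟩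
    exact hm
  have hsimg : (Subtype.val '' s).Finite := (Set.finite_lt_nat M).subset hsM
  have hs : s.Finite := hsimg.of_finite_image Subtype.val_injective.injOn
  have : FiniteDimensional ℝ (Submodule.span ℝ (b '' s)) :=
    FiniteDimensional.span_of_finite ℝ (hs.image b)
  refine ⟨Submodule.span ℝ (b '' s), inferInstance, ?_, fun z => ?_⟩
  · have h1 := finrank_span_finset_le_card (R := ℝ) (hs.image b).toFinset
    rw [Set.Finite.coe_toFinset] at h1
    refine h1.trans ?_
    rw [← Set.ncard_eq_toFinset_card _ (hs.image b)]
    refine (Set.ncard_image_le hs).trans ?_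
    rw [← Set.ncard_image_of_injective s Subtype.val_injective]
    calc _ ≤ (Set.Iio M).ncard := Set.ncard_le_ncard hsM (Set.finite_Iio M)
      _ = M := by simp [Set.ncard_eq_toFinset_card']
  · set V := Submodule.span ℝ (b '' s)
    set w := ψ z - V.starProjection (ψ z) with hw
    have hwV : w ∈ Vᗮ := Submodule.sub_starProjection_mem_orthogonal _
    have hsum := b.hasSum_inner_mul_inner w w
    rw [real_inner_self_eq_norm_sq] at hsum
    let f : ℕ → ℝ := fun m => if m < M then 0 else a m
    have hf0 : ∀ m, 0 ≤ f m := fun m => by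
      simp only [f]
      split_ifs
      exacts [le_rfl, ha m]
    -- The residual `w` has no coefficient below `M`, and from `M` on it has the same coefficients
    -- as `ψ z`, since those basis vectors are orthogonal to `V`.
    have hterm : ∀ m : {m // p m}, inner ℝ w (b m) * inner ℝ (b m) w ≤ f m := by
      intro m
      rw [real_inner_comm (b m) w, ← sq]
      simp only [f]
      split_ifs with hm
      · have : inner ℝ (b m) w = 0 := (Submodule.mem_orthogonal _ _).1 hwV _
          (Submodule.subset_span (mem_image_of_mem b hm))
        simp [this]
      · have hperp : b m ∈ Vᗮ := by
          rw [Submodule.mem_orthogonal']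
          intro u hu
          induction hu using Submodule.span_induction with
          | mem x hx =>
            obtain ⟨n, hn, rfl⟩ := hx
            exact b.orthonormal.2 (fun h => hm (h ▸ hn))
          | zero => exact inner_zero_right _
          | add x y _ _ hx hy => rw [inner_add_right, hx, hy, add_zero]
          | smul c x _ hx => rw [inner_smul_right, hx, mul_zero]
        have : inner ℝ (b m) (V.starProjection (ψ z)) = 0 :=
          (Submodule.mem_orthogonal' _ _).1 hperp _ (Submodule.starProjection_apply_mem _ _)
        rw [hw, inner_sub_right, this, sub_zero]
        exact hb m z
    refine hasSum_le_of_sum_le hsum fun t => ?_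
    let t' : Finset ℕ := t.map ⟨Subtype.val, Subtype.val_injective⟩
    obtain ⟨N, hN⟩ := Finset.exists_nat_subset_range t'
    calc ∑ m ∈ t, inner ℝ w (b m) * inner ℝ (b m) w ≤ ∑ m ∈ t, f m :=
          Finset.sum_le_sum fun m _ => hterm m
      _ = ∑ m ∈ t', f m := by simp [t']
      _ ≤ ∑ m ∈ Finset.range (M + N), f m :=
          Finset.sum_le_sum_of_subset_of_nonneg
            (hN.trans (Finset.range_mono (Nat.le_add_left _ _))) fun m _ _ => hf0 m
      _ = ∑ i ∈ Finset.range N, a (M + i) := by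
          rw [Finset.sum_range_add, Finset.sum_eq_zero, zero_add]
          · exact Finset.sum_congr rfl fun i _ => by simp [f]
          · intro m hm
            simp [f, Finset.mem_range.1 hm]
      _ ≤ τ := hτ N

/-- A telescoping substitute for comparing the tail sum with `∫ x^{-p}`. After division by
`(x+1)^{1-p}` it follows from `exp t ≥ 1 + t` and `log u ≤ u - 1`. -/
theorem mul_add_one_rpow_neg_le {p : ℝ} (hp : 1 < p) {x : ℝ} (hx : 0 < x) :
    (p - 1) * (x + 1) ^ (-p) ≤ x ^ (1 - p) - (x + 1) ^ (1 - p) := by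
  have hx1 : 0 < x + 1 := by linarith
  have h1 : 1 + (p - 1) * (1 / (x + 1)) ≤ (x / (x + 1)) ^ (1 - p) := by
    rw [Real.rpow_def_of_pos (by positivity)]
    have h2 := Real.add_one_le_exp (Real.log (x / (x + 1)) * (1 - p))
    have h3 := Real.log_le_sub_one_of_pos (show 0 < x / (x + 1) by positivity)
    have h4 : x / (x + 1) - 1 = -(1 / (x + 1)) := by field_simp; ring
    rw [h4] at h3
    nlinarith
  rw [Real.div_rpow hx.le hx1.le, le_div_iff₀ (by positivity)] at h1
  have h5 : (x + 1) ^ (-p) = 1 / (x + 1) * (x + 1) ^ (1 - p) := by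
    rw [show 1 - p = -p + 1 by ring, Real.rpow_add_one hx1.ne']
    field_simp
  rw [h5]
  linarith

/-- The factor is `p/(p-1) = 1/(p-1) + 1`: the terms with `i ≥ 1` telescope to the first part, and
the term `i = 0` is absorbed by the second. -/
theorem sum_range_rpow_neg_le {p : ℝ} (hp : 1 < p) (M n : ℕ) :
    ∑ i ∈ Finset.range n, (((M + i : ℕ) : ℝ) + 1) ^ (-p) ≤
      p / (p - 1) * ((M : ℝ) + 1) ^ (1 - p) := by
  have hp' : 0 < p - 1 := by linarith
  have hM : (0 : ℝ) < M + 1 := by positivity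
  have key : ∀ n : ℕ, (p - 1) * ∑ i ∈ Finset.range n, (((M + (i + 1) : ℕ) : ℝ) + 1) ^ (-p) ≤
      ((M : ℝ) + 1) ^ (1 - p) - (((M + n : ℕ) : ℝ) + 1) ^ (1 - p) := by
    intro n
    induction n with
    | zero => simp
    | succ n ih =>
      rw [Finset.sum_range_succ, mul_add]
      have := mul_add_one_rpow_neg_le hp (show (0 : ℝ) < ((M + n : ℕ) : ℝ) + 1 by positivity)
      have e : ((M + (n + 1) : ℕ) : ℝ) + 1 = ((M + n : ℕ) : ℝ) + 1 + 1 := by push_cast; ring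
      rw [e]
      linarith
  have hfirst : ((M : ℝ) + 1) ^ (-p) ≤ ((M : ℝ) + 1) ^ (1 - p) :=
    Real.rpow_le_rpow_of_exponent_le (by linarith [Nat.cast_nonneg (α := ℝ) M]) (by linarith)
  have e : p / (p - 1) * ((M : ℝ) + 1) ^ (1 - p) =
      ((M : ℝ) + 1) ^ (1 - p) / (p - 1) + ((M : ℝ) + 1) ^ (1 - p) := by
    field_simp
    ring
  rw [e]
  cases n with
  | zero => simp only [Finset.range_zero, Finset.sum_empty]; positivity
  | succ n =>
    rw [Finset.sum_range_succ']
    refine add_le_add ?_ (by simpa using hfirst)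
    rw [le_div_iff₀ hp', mul_comm]
    refine (key n).trans (sub_le_self _ (by positivity))

end Mercer

/-! ### Covering the function class. -/

section QClass

theorem abs_clip_sub_clip_le (a b c : ℝ) :
    |max (min a c) 0 - max (min b c) 0| ≤ |a - b| := by
  refine (abs_max_sub_max_le_abs _ _ _).trans ?_
  simpa using abs_min_sub_min_le_max a c b c

variable {F : Type*} [NormedAddCommGroup F] [InnerProductSpace ℝ F]

/-- The error splits into `v` tested on the part of `u` outside `V` and the discretisation error of
the projection of `v`. -/
theorem abs_inner_sub_inner_le (V : Submodule ℝ F) [V.HasOrthogonalProjection] {R κ η : ℝ}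
    (hη : 0 ≤ η) {v u : F} (hv : ‖v‖ ≤ R) (hu : ‖u‖ ≤ κ) {c : V}
    (hc : ‖V.orthogonalProjectionOnto v - c‖ ≤ η) :
    |inner ℝ v u - inner ℝ (c : F) u| ≤ R * ‖u - V.starProjection u‖ + η * κ := by
  have e : inner ℝ v u - inner ℝ (c : F) u =
      inner ℝ v (u - V.starProjection u) + inner ℝ (V.starProjection v - c) u := by
    rw [inner_sub_right, inner_sub_left, V.inner_starProjection_left_eq_right]
    ring
  rw [e]
  refine (abs_add_le _ _).trans (add_le_add ?_ ?_)
  · exact (abs_real_inner_le_norm _ _).trans (by gcongr)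
  · exact (abs_real_inner_le_norm _ _).trans
      (mul_le_mul hc hu (norm_nonneg _) hη)

/-- The contraction property of `L` controls the part of `u` outside `V`; on `V`, `β L` may be
replaced by `S` because only norms enter, and then by the net point `S'`. -/
theorem abs_mul_norm_sub_norm_le {F' : Type*} [NormedAddCommGroup F'] [InnerProductSpace ℝ F']
    (V : Submodule ℝ F) [V.HasOrthogonalProjection] {β B κ η : ℝ} (hβ : β ∈ Icc 0 B)
    (hη : 0 ≤ η) (L : F →ₗ[ℝ] F') (hL : ∀ v, ‖L v‖ ≤ ‖v‖) {S S' : V →L[ℝ] V}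
    (hS : ∀ v : V, ‖S v‖ = β * ‖L v‖) (hSS' : ‖S - S'‖ ≤ η) {u : F} (hu : ‖u‖ ≤ κ) :
    |β * ‖L u‖ - ‖S' (V.orthogonalProjectionOnto u)‖| ≤ B * ‖u - V.starProjection u‖ + η * κ := by
  set w := V.orthogonalProjectionOnto u with hw
  have hwu : (w : F) = V.starProjection u := rfl
  have h1 : |β * ‖L u‖ - ‖S w‖| ≤ B * ‖u - V.starProjection u‖ := by
    rw [hS, ← mul_sub, abs_mul, abs_of_nonneg hβ.1]
    refine mul_le_mul hβ.2 ?_ (abs_nonneg _) (hβ.1.trans hβ.2)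
    refine (abs_norm_sub_norm_le _ _).trans ?_
    rw [← map_sub, hwu]
    exact hL _
  have h2 : |‖S w‖ - ‖S' w‖| ≤ η * κ := by
    refine (abs_norm_sub_norm_le _ _).trans ?_
    rw [← sub_apply]
    refine (ContinuousLinearMap.le_opNorm _ _).trans
      (mul_le_mul hSS' ?_ (norm_nonneg _) hη)
    exact (V.norm_orthogonalProjectionOnto_apply_le u).trans hu
  calc _ = |(β * ‖L u‖ - ‖S w‖) + (‖S w‖ - ‖S' w‖)| := by rw [sub_add_sub_cancel]
    _ ≤ _ := (abs_add_le _ _).trans (add_le_add h1 h2)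

theorem coveringNumber_qClass_le [CompleteSpace F] {X : Type} {k : X → X → ℝ} (hk : IsPosDefKernel k)
    {ψ : X → F} (hψ : ∀ x y, k x y = inner ℝ (ψ x) (ψ y))
    (hball : ∀ R f, f ∈ rkhsBall hk R → ∃ v : F, ‖v‖ ≤ R ∧ ∀ x, f x = inner ℝ v (ψ x))
    {ρ : ℝ} (hρ : 0 < ρ) (T H h : ℕ) {B R κ : ℝ} (hB : 0 ≤ B) (hR : 0 ≤ R) (hκ : 0 < κ)
    {ε : ℝ≥0} (hε : 0 < ε) (hψκ : ∀ z, ‖ψ z‖ ≤ κ) (V₁ V₂ : Submodule ℝ F)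
    [FiniteDimensional ℝ V₁] [FiniteDimensional ℝ V₂]
    (h₁ : ∀ z, R * ‖ψ z - V₁.starProjection (ψ z)‖ ≤ ε / 8)
    (h₂ : ∀ z, B * ‖ψ z - V₂.starProjection (ψ z)‖ ≤ ε / 8) :
    Metric.coveringNumber ε (qClass hk ρ T H h B R) ≠ ⊤ ∧
      ((Metric.coveringNumber ε (qClass hk ρ T H h B R)).toNat : ℝ) ≤
        (1 + 16 * κ * (R / ε)) ^ Module.finrank ℝ V₁ *
          (1 + 16 * κ * (B / ε)) ^ (Module.finrank ℝ V₂ ^ 2) := by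
  classical
  have hε' : (0 : ℝ) < ε := hε
  -- Four errors of `ε/8` each, truncation and discretisation for both terms, add up to `ε/2`.
  set η : ℝ := ε / (8 * κ) with hηdef
  have hη : 0 < η := by positivity
  have hηκ : η * κ = ε / 8 := by rw [hηdef]; field_simp
  have hηr : ∀ r, 2 * r / η = 16 * κ * (r / ε) := fun r => by rw [hηdef]; field_simp; ring
  obtain ⟨s₁, hs₁, hcov₁⟩ := exists_finset_cover_closedBall (E := V₁) hR hη
  obtain ⟨s₂, hs₂, hcov₂⟩ := exists_finset_cover_closedBall (E := V₂ →L[ℝ] V₂) hB hη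
  have hfin : Module.finrank ℝ (V₂ →L[ℝ] V₂) = Module.finrank ℝ V₂ ^ 2 := by
    rw [← (LinearMap.toContinuousLinearMap (𝕜 := ℝ) (E := V₂) (F' := V₂)).finrank_eq,
      Module.finrank_linearMap, sq]
  rw [hηr] at hs₁ hs₂
  rw [hfin] at hs₂
  let g : V₁ × (V₂ →L[ℝ] V₂) → (X →ᵤ ℝ) := fun q => UniformFun.ofFun fun z =>
    max (min (inner ℝ (q.1 : F) (ψ z) + ‖q.2 (V₂.orthogonalProjectionOnto (ψ z))‖)
      ((H : ℝ) - h + 1)) 0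
  -- The centres need not lie in the class. An external cover at radius `ε/2` yields an internal one
  -- at radius `ε` of no larger cardinality.
  have hcover : Metric.IsCover (ε / 2) (qClass hk ρ T H h B R)
      (((s₁ ×ˢ s₂).image g : Finset (X →ᵤ ℝ)) : Set (X →ᵤ ℝ)) := by
    rintro Q ⟨t, -, pts, Q₀, hQ₀, β, hβ, rfl⟩
    obtain ⟨v, hv, hvQ⟩ := hball R Q₀ hQ₀
    obtain ⟨L, hL, hLb⟩ := exists_contraction_bonus_eq ψ hψ hρ pts
    obtain ⟨c, hc, hvc⟩ := hcov₁ (V₁.orthogonalProjectionOnto v)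
      ((V₁.norm_orthogonalProjectionOnto_apply_le v).trans hv)
    obtain ⟨S, hS⟩ := exists_endomorphism_norm_eq (β • (L ∘ₗ V₂.subtype))
    have hS' : ∀ v : V₂, ‖S v‖ = β * ‖L v‖ := fun v => by
      rw [hS, LinearMap.smul_apply, norm_smul, Real.norm_of_nonneg hβ.1]
      rfl
    obtain ⟨S', hS'mem, hSS'⟩ := hcov₂ S (S.opNorm_le_bound hB fun v => by
      rw [hS']
      exact mul_le_mul hβ.2 (hL v) (norm_nonneg _) hB)
    refine ⟨g (c, S'), by
      simpa using ⟨c, c.2, S', ⟨hc, hS'mem⟩, rfl⟩, ?_⟩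
    change edist _ _ ≤ ((ε / 2 : ℝ≥0) : ENNReal)
    rw [UniformFun.edist_le]
    intro z
    rw [edist_dist, ← ENNReal.ofReal_coe_nnreal]
    refine ENNReal.ofReal_le_ofReal ?_
    rw [Real.dist_eq]
    refine (abs_clip_sub_clip_le _ _ _).trans ?_
    rw [hvQ, hLb]
    have b₁ := abs_inner_sub_inner_le V₁ hη.le hv (hψκ z) hvc
    have b₂ := abs_mul_norm_sub_norm_le V₂ hβ hη.le L hL hS' hSS' (hψκ z)
    rw [hηκ] at b₁ b₂
    have := h₁ z
    have := h₂ z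
    calc _ ≤ |inner ℝ v (ψ z) - inner ℝ (c : F) (ψ z)| +
          |β * ‖L (ψ z)‖ - ‖S' (V₂.orthogonalProjectionOnto (ψ z))‖| := by
          refine le_trans (le_of_eq ?_) (abs_add_le _ _)
          congr 1
          ring
      _ ≤ ((ε / 2 : ℝ≥0) : ℝ) := by
          push_cast
          linarith
  have hle : Metric.coveringNumber ε (qClass hk ρ T H h B R) ≤ ((s₁.card * s₂.card : ℕ) : ℕ∞) := by
    have h1 := Metric.coveringNumber_two_mul_le_externalCoveringNumber (ε / 2)
      (qClass hk ρ T H h B R)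
    rw [mul_div_cancel₀ ε two_ne_zero] at h1
    refine h1.trans (hcover.externalCoveringNumber_le_encard.trans ?_)
    rw [Set.encard_coe_eq_coe_finsetCard]
    have h2 : ((s₁ ×ˢ s₂).image g).card ≤ s₁.card * s₂.card :=
      Finset.card_image_le.trans_eq (Finset.card_product _ _)
    exact_mod_cast h2
  refine ⟨ne_top_of_le_ne_top (ENat.natCast_ne_top _) hle, ?_⟩
  have h3 : (Metric.coveringNumber ε (qClass hk ρ T H h B R)).toNat ≤ s₁.card * s₂.card :=
    ENat.toNat_le_of_le_natCast hle
  calc _ ≤ ((s₁.card * s₂.card : ℕ) : ℝ) := by exact_mod_cast h3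
    _ ≤ _ := by
      push_cast
      exact mul_le_mul hs₁ hs₂ (by positivity) (by positivity)

end QClass

/-! ### Regularity of the invariant kernel. -/

section Invariant

variable {d : ℕ}
  {G : Subgroup (EuclideanSpace ℝ (Fin d) ≃ₗᵢ[ℝ] EuclideanSpace ℝ (Fin d))}
  {Z : Set (EuclideanSpace ℝ (Fin d))}

theorem continuous_act (hZ : ∀ g ∈ G, ∀ z ∈ Z, g z ∈ Z) (g : G) : Continuous (act hZ g) :=
  (g.1.continuous.comp continuous_subtype_val).subtype_mk _

theorem continuous_invariantKernel [Fintype G] (hZ : ∀ g ∈ G, ∀ z ∈ Z, g z ∈ Z) {k : Z → Z → ℝ}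
    (hk : Continuous fun q : Z × Z => k q.1 q.2) :
    Continuous fun q : Z × Z => invariantKernel hZ k q.1 q.2 := by
  refine continuous_const.mul (continuous_finsetSum _ fun g _ => ?_)
  exact hk.comp (((continuous_act hZ g).comp continuous_fst).prodMk continuous_snd)

/-- Invariance gives `‖ψ (g z)‖ = ‖ψ z‖`, so Cauchy–Schwarz bounds each summand. This passes
integrability of the diagonal from `k` to `k_G`. -/
theorem abs_invariantKernel_self_le [Fintype G] {hZ : ∀ g ∈ G, ∀ z ∈ Z, g z ∈ Z} {k : Z → Z → ℝ}
    (hk : IsPosDefKernel k)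
    (hinv : ∀ (g : G) (z z' : Z), k (act hZ g z) (act hZ g z') = k z z') (z : Z) :
    |invariantKernel hZ k z z| ≤ k z z := by
  obtain ⟨F, _, _, _, ψ, hψ, -, -⟩ := exists_feature_map hk
  have hG : (0 : ℝ) < Fintype.card G := by exact_mod_cast Fintype.card_pos
  have hterm : ∀ g : G, |k (act hZ g z) z| ≤ k z z := by
    intro g
    have h1 : ‖ψ (act hZ g z)‖ = ‖ψ z‖ := by
      rw [← sq_eq_sq₀ (norm_nonneg _) (norm_nonneg _), ← real_inner_self_eq_norm_sq,
        ← real_inner_self_eq_norm_sq, ← hψ, ← hψ, hinv]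
    rw [hψ, hψ z z, real_inner_self_eq_norm_sq, sq]
    refine (abs_real_inner_le_norm _ _).trans_eq (by rw [h1])
  rw [invariantKernel, abs_mul, abs_of_pos (inv_pos.2 hG), inv_mul_le_iff₀ hG]
  refine (Finset.abs_sum_le_sum_abs _ _).trans ((Finset.sum_le_sum fun g _ => hterm g).trans_eq ?_)
  simp

end Invariant

/-! ### Choice of the truncation level and bookkeeping of constants. -/

section Constants

theorem log_one_add_mul_le {κ r : ℝ} (hκ : 0 ≤ κ) (hr : 0 ≤ r) :
    Real.log (1 + κ * r) ≤ (1 + Real.log (1 + κ)) * (1 + Real.posLog r) := by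
  have h0 : 0 ≤ Real.log (1 + κ) := Real.log_nonneg (by linarith)
  have hp : 0 ≤ Real.posLog r := Real.posLog_nonneg
  have key : Real.log (1 + κ * r) ≤ Real.log (1 + κ) + Real.posLog r := by
    rcases le_total r 1 with h | h
    · have : Real.log (1 + κ * r) ≤ Real.log (1 + κ) :=
        Real.log_le_log (by positivity) (by nlinarith)
      linarith
    · have h1 : Real.log (1 + κ * r) ≤ Real.log ((1 + κ) * r) :=
        Real.log_le_log (by positivity) (by nlinarith)
      rw [Real.log_mul (by positivity) (by positivity)] at h1
      have : Real.log r ≤ Real.posLog r := le_max_right _ _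
      linarith
  nlinarith [mul_nonneg h0 hp]

/-- `M` is chosen so that `(M+1)^{p-1} ≥ 64 D r² / (ε² g^p)`; the factor `64 = 8²` produces `ε/8`.
-/
theorem mul_le_of_sq_le_truncation {p D g ε r w : ℝ} (hp : 1 < p) (hD : 0 < D) (hg : 0 < g)
    (hε : 0 < ε) {M : ℕ}
    (hM : M = ⌊(64 * D * (r ^ 2 / (ε ^ 2 * g ^ p))) ^ (1 / (p - 1))⌋₊)
    (hw : w ^ 2 ≤ D * g ^ (-p) * ((M : ℝ) + 1) ^ (1 - p)) : r * w ≤ ε / 8 := by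
  have hp' : 0 < p - 1 := by linarith
  have hgp : 0 < g ^ p := by positivity
  have hM1 : (0 : ℝ) < M + 1 := by positivity
  have hx : 0 ≤ 64 * D * (r ^ 2 / (ε ^ 2 * g ^ p)) := by positivity
  have h1 : 64 * D * (r ^ 2 / (ε ^ 2 * g ^ p)) ≤ ((M : ℝ) + 1) ^ (p - 1) := by
    have h2 := (Nat.lt_floor_add_one
      ((64 * D * (r ^ 2 / (ε ^ 2 * g ^ p))) ^ (1 / (p - 1)))).le
    rw [← hM] at h2
    have h3 := Real.rpow_le_rpow (by positivity) h2 hp'.le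
    rwa [← Real.rpow_mul hx, one_div_mul_cancel hp'.ne', Real.rpow_one] at h3
  have e : ((M : ℝ) + 1) ^ (1 - p) = (((M : ℝ) + 1) ^ (p - 1))⁻¹ := by
    rw [← Real.rpow_neg hM1.le, neg_sub]
  have hQ : 0 < ((M : ℝ) + 1) ^ (p - 1) := by positivity
  refine (abs_le_of_sq_le_sq' ?_ (by positivity)).2
  calc (r * w) ^ 2 = r ^ 2 * w ^ 2 := by ring
    _ ≤ r ^ 2 * (D * g ^ (-p) * ((M : ℝ) + 1) ^ (1 - p)) := by gcongr
    _ = (64 * D * (r ^ 2 / (ε ^ 2 * g ^ p))) * (((M : ℝ) + 1) ^ (p - 1))⁻¹ * (ε ^ 2 / 64) := by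
        rw [e, Real.rpow_neg hg.le]
        field_simp
    _ ≤ 1 * (ε ^ 2 / 64) := by
        gcongr
        rw [← div_eq_mul_inv]
        exact (div_le_one hQ).2 h1
    _ = (ε / 8) ^ 2 := by ring

theorem floor_mul_rpow_le {c x s : ℝ} (hc : 0 ≤ c) (hx : 0 ≤ x) :
    (⌊(c * x) ^ s⌋₊ : ℝ) ≤ c ^ s * x ^ s := by
  rw [← Real.mul_rpow hc hx]
  exact Nat.floor_le (by positivity)

end Constants

end KOVI

/-! ### Assembly of the bound. -/

theorem theorem1 (p Clam Cphi : ℝ) (hp : 1 < p) (hClam : 0 < Clam) (hCphi : 0 < Cphi) :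
    ∃ C > 0,
      ∀ (d : ℕ) (Z : Set (EuclideanSpace ℝ (Fin d)))
        (G : Subgroup (EuclideanSpace ℝ (Fin d) ≃ₗᵢ[ℝ] EuclideanSpace ℝ (Fin d)))
        [Fintype G] (hZ : ∀ g ∈ G, ∀ z ∈ Z, g z ∈ Z)
        (μ : Measure Z) [μ.IsOpenPosMeasure]
        (k : Z → Z → ℝ) (hk : KOVI.IsPosDefKernel k)
        (hinv : ∀ (g : G) (z z' : Z), k (KOVI.act hZ g z) (KOVI.act hZ g z') = k z z')
        (_hcont : Continuous fun q : Z × Z => k q.1 q.2)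
        (_hint : Integrable (fun z => k z z) μ)
        (lam : ℕ → ℝ) (phi : ℕ → Z → ℝ)
        (_hsys : KOVI.IsMercerEigensystem μ (KOVI.invariantKernel hZ k) lam phi)
        (_hphi : ∀ m, lam m ≠ 0 → ∀ z, |phi m z| ≤ Cphi)
        (_hlam : ∀ m : ℕ, lam m ≤ Clam * (((m : ℝ) + 1) * (Fintype.card G : ℝ)) ^ (-p))
        (ρ : ℝ) (_hρ : 0 < ρ) (T H h : ℕ) (_h1 : 1 ≤ h) (_hH : h ≤ H)
        (B R : ℝ) (_hB : 0 ≤ B) (_hR : 0 ≤ R) (ε : ℝ≥0) (_hε : 0 < ε),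
        Metric.coveringNumber ε
            (KOVI.qClass (hk.invariantKernel hinv) ρ T H h B R) ≠ ⊤ ∧
          Real.log (Metric.coveringNumber ε
            (KOVI.qClass (hk.invariantKernel hinv) ρ T H h B R)).toNat ≤
            C * ((R ^ 2 / ((ε : ℝ) ^ 2 * (Fintype.card G : ℝ) ^ p)) ^ (1 / (p - 1)) *
                  (1 + Real.posLog (R / ε)) +
                (B ^ 2 / ((ε : ℝ) ^ 2 * (Fintype.card G : ℝ) ^ p)) ^ (2 / (p - 1)) *
                  (1 + Real.posLog (B / ε))) := by
  have hp' : 0 < p - 1 := by linarith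
  -- `D` is the constant of the squared Mercer tail, `κ` a uniform bound on `‖ψ z‖`, `c` the
  -- logarithmic factor, and `q` the constant in the truncation dimension.
  set D : ℝ := Cphi ^ 2 * Clam * (p / (p - 1)) with hD
  have hDpos : 0 < D := by positivity
  set κ : ℝ := Real.sqrt D with hκ
  have hκpos : 0 < κ := Real.sqrt_pos.2 hDpos
  set c : ℝ := 1 + Real.log (1 + 16 * κ) with hc
  have hcpos : 0 < c := by
    have := Real.log_nonneg (show 1 ≤ 1 + 16 * κ by linarith)
    linarith
  set q : ℝ := (64 * D) ^ (1 / (p - 1)) with hq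
  have hqpos : 0 < q := by positivity
  refine ⟨c * (q + q ^ 2), by positivity, ?_⟩
  intro d Z G _ hZ μ _ k hk hinv hcont hint lam phi hsys hphi hlam ρ hρ T H h _ _ B R hB hR ε hε
  have hε' : (0 : ℝ) < ε := hε
  set g : ℝ := (Fintype.card G : ℝ) with hg
  have hg1 : 1 ≤ g := Nat.one_le_cast.2 Fintype.card_pos
  have hgpos : 0 < g := by linarith
  obtain ⟨F, _, _, _, ψ, hψ, hsep, hball⟩ := KOVI.exists_feature_map (hk.invariantKernel hinv)
  have hkc := KOVI.continuous_invariantKernel hZ hcont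
  have hψc := KOVI.continuous_feature_map hψ hkc
  have hint' : Integrable (fun z => KOVI.invariantKernel hZ k z z) μ := by
    refine hint.mono' (hkc.comp (continuous_id.prodMk continuous_id)).aestronglyMeasurable ?_
    filter_upwards with z
    exact KOVI.abs_invariantKernel_self_le hk hinv z
  obtain ⟨b, hb⟩ := hsys.exists_hilbertBasis hψ hψc hsep hint'
  set a : ℕ → ℝ := fun m => Cphi ^ 2 * (Clam * (((m : ℝ) + 1) * g) ^ (-p)) with ha
  have ha0 : ∀ m, 0 ≤ a m := fun m => by positivity
  have hba : ∀ m z, inner ℝ (b m) (ψ z) ^ 2 ≤ a m := by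
    intro m z
    rw [hb, mul_pow, Real.sq_sqrt (hsys.nonneg m), mul_comm]
    have h1 : phi m z ^ 2 ≤ Cphi ^ 2 := sq_le_sq' (by linarith [abs_le.1 (hphi m m.2 z)])
      (abs_le.1 (hphi m m.2 z)).2
    exact mul_le_mul h1 (hlam m) (hsys.nonneg m) (by positivity)
  have hsum : ∀ M n, ∑ i ∈ Finset.range n, a (M + i) ≤ D * g ^ (-p) * ((M : ℝ) + 1) ^ (1 - p) := by
    intro M n
    have h1 : ∀ m, a m = Cphi ^ 2 * Clam * g ^ (-p) * ((m : ℝ) + 1) ^ (-p) := fun m => by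
      simp only [ha]
      rw [Real.mul_rpow (by positivity) hgpos.le]
      ring
    simp only [h1]
    rw [← Finset.mul_sum]
    calc _ ≤ Cphi ^ 2 * Clam * g ^ (-p) * (p / (p - 1) * ((M : ℝ) + 1) ^ (1 - p)) := by
          gcongr
          exact KOVI.sum_range_rpow_neg_le hp M n
      _ = _ := by rw [hD]; ring
  have htrunc := fun M => KOVI.exists_submodule_norm_sub_le b ψ ha0 hba M (hsum M)
  have hψκ : ∀ z, ‖ψ z‖ ≤ κ := by
    -- At `M = 0` the subspace is trivial and the tail bound controls `‖ψ z‖²` itself; `g ≥ 1` makes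
    -- the bound independent of the group.
    obtain ⟨V, _, hV, hVψ⟩ := htrunc 0
    intro z
    have hV0 : V = ⊥ := Submodule.finrank_eq_zero.1 (Nat.le_zero.1 hV)
    have h1 := hVψ z
    subst hV0
    rw [Submodule.starProjection_bot] at h1
    refine Real.le_sqrt_of_sq_le ?_
    have h2 : g ^ (-p) ≤ 1 := Real.rpow_le_one_of_one_le_of_nonpos hg1 (by linarith)
    simp only [zero_apply, sub_zero, Nat.cast_zero, zero_add,
      Real.one_rpow, mul_one] at h1
    nlinarith
  obtain ⟨V₁, _, hV₁, hVψ₁⟩ :=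
    htrunc ⌊(64 * D * (R ^ 2 / ((ε : ℝ) ^ 2 * g ^ p))) ^ (1 / (p - 1))⌋₊
  obtain ⟨V₂, _, hV₂, hVψ₂⟩ :=
    htrunc ⌊(64 * D * (B ^ 2 / ((ε : ℝ) ^ 2 * g ^ p))) ^ (1 / (p - 1))⌋₊
  obtain ⟨htop, hN⟩ := KOVI.coveringNumber_qClass_le (hk.invariantKernel hinv) hψ hball hρ T H h
    hB hR hκpos hε hψκ V₁ V₂
    (fun z => KOVI.mul_le_of_sq_le_truncation hp hDpos hgpos hε' rfl (hVψ₁ z))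
    (fun z => KOVI.mul_le_of_sq_le_truncation hp hDpos hgpos hε' rfl (hVψ₂ z))
  refine ⟨htop, ?_⟩
  set N := (Metric.coveringNumber ε (KOVI.qClass (hk.invariantKernel hinv) ρ T H h B R)).toNat
  set x := R ^ 2 / ((ε : ℝ) ^ 2 * g ^ p) with hx
  set y := B ^ 2 / ((ε : ℝ) ^ 2 * g ^ p) with hy
  have hx0 : 0 ≤ x := by positivity
  have hy0 : 0 ≤ y := by positivity
  have hn₁ : (Module.finrank ℝ V₁ : ℝ) ≤ q * x ^ (1 / (p - 1)) :=
    (Nat.cast_le.2 hV₁).trans (KOVI.floor_mul_rpow_le (by positivity) hx0)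
  have hn₂ : ((Module.finrank ℝ V₂ ^ 2 : ℕ) : ℝ) ≤ q ^ 2 * y ^ (2 / (p - 1)) := by
    have h1 : (Module.finrank ℝ V₂ : ℝ) ≤ q * y ^ (1 / (p - 1)) :=
      (Nat.cast_le.2 hV₂).trans (KOVI.floor_mul_rpow_le (by positivity) hy0)
    have h2 : y ^ (2 / (p - 1)) = (y ^ (1 / (p - 1))) ^ 2 := by
      rw [← Real.rpow_natCast, ← Real.rpow_mul hy0]
      congr 1
      push_cast
      ring
    rw [h2, ← mul_pow]
    push_cast
    gcongr
  have hlogR := KOVI.log_one_add_mul_le (κ := 16 * κ) (r := R / ε) (by positivity) (by positivity)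
  have hlogB := KOVI.log_one_add_mul_le (κ := 16 * κ) (r := B / ε) (by positivity) (by positivity)
  have hRpos : 0 < 1 + 16 * κ * (R / ε) := by positivity
  have hBpos : 0 < 1 + 16 * κ * (B / ε) := by positivity
  have hlR : 0 ≤ Real.log (1 + 16 * κ * (R / ε)) :=
    Real.log_nonneg (le_add_of_nonneg_right (by positivity))
  have hlB : 0 ≤ Real.log (1 + 16 * κ * (B / ε)) :=
    Real.log_nonneg (le_add_of_nonneg_right (by positivity))
  have hpR : 0 ≤ Real.posLog (R / ε) := Real.posLog_nonneg
  have hpB : 0 ≤ Real.posLog (B / ε) := Real.posLog_nonneg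
  have hlogN : Real.log N ≤ Module.finrank ℝ V₁ * Real.log (1 + 16 * κ * (R / ε)) +
      (Module.finrank ℝ V₂ ^ 2 : ℕ) * Real.log (1 + 16 * κ * (B / ε)) := by
    -- The convention `log 0 = 0` makes it unnecessary to show that the class is nonempty.
    rcases Nat.eq_zero_or_pos N with hN0 | hNpos
    · rw [hN0, Nat.cast_zero, Real.log_zero]
      positivity
    · have h1 := Real.log_le_log (by exact_mod_cast hNpos) hN
      rwa [Real.log_mul (by positivity) (by positivity), Real.log_pow, Real.log_pow] at h1
  have hA : Module.finrank ℝ V₁ * Real.log (1 + 16 * κ * (R / ε)) ≤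
      q * x ^ (1 / (p - 1)) * (c * (1 + Real.posLog (R / ε))) :=
    mul_le_mul hn₁ hlogR hlR (by positivity)
  have hB' : (Module.finrank ℝ V₂ ^ 2 : ℕ) * Real.log (1 + 16 * κ * (B / ε)) ≤
      q ^ 2 * y ^ (2 / (p - 1)) * (c * (1 + Real.posLog (B / ε))) :=
    mul_le_mul hn₂ hlogB hlB (by positivity)
  -- These are the surplus cross terms from using the single constant `c (q + q²)` for both
  -- summands.
  have e₁ : 0 ≤ c * q ^ 2 * (x ^ (1 / (p - 1)) * (1 + Real.posLog (R / ε))) := by positivity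
  have e₂ : 0 ≤ c * q * (y ^ (2 / (p - 1)) * (1 + Real.posLog (B / ε))) := by positivity
  linarith
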